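/- The terms of the $\lambda\bot$-calculus are generated, up to $\alpha$-conversion, by $M ::= x \mid \bot \mid \lambda x.M \mid MM$, where $x$ ranges over a countably infinite set of variables (terms need not be closed). Reduction is the reflexive, transitive and contextual closure of $(\lambda x.M)N \to M\{N/x\}$, $\bot M \to \bot$ and $\lambda x.\bot \to \bot$; we write $M = N$ if $M$ and $N$ reduce to a common term. Put $\mathbf I = \lambda x.x$, $\mathbf B = \lambda xyz.x(yz)$ and $M\circ N = \mathbf B M N$. A left inverse of a term $M$ is a term $L$ such that $L \circ M = \mathbf I$. Let $\Xi$ be the smallest set of head normal forms such that - $\lambda t x_1\ldots x_n.t \in \Xi$ for all $n \ge 0$; - if $1 \le j \le n$, $1 \le i \le m$ and $\lambda t x_1\ldots x_n.M_i \in \Xi$, then $\lambda t x_1\ldots x_n.x_j M_1\ldots M_i\ldots M_m \in \Xi$ (here $t, x_1,\ldots,x_n$ are distinct variables, and $M_1,\ldots,M_m$ are arbitrary terms). Theorem. A term $M$ of the $\lambda\bot$-calculus has at least one left inverse if and only if it reduces to a head normal form in $\Xi$. Moreover, if $M$ reduces to a head normal form in $\Xi$, then it has a left inverse of the form $\lambda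 z.z L_1\ldots L_q$ with $q \ge 0$, in which every $L_l$ is $\bot$, a selector $\lambda y_1\ldots y_m.y_i$ with $1 \le i \le m$, or a permutator $\lambda z_1\ldots z_{m+1}.z_{m+1}z_1\ldots z_m$ with $m \ge 1$. -/

import Mathlib

namespace LambdaBot

/-- Terms of the `λ⊥`-calculus up to `α`-conversion, in de Bruijn notation: `var k` is bound by
the `(k+1)`-st enclosing abstraction if there is one, and is a free variable otherwise. -/
inductive Term : Type
  | var : ℕ → Term
  | bot : Term
  | lam : Term → Term
  | app : Term → Term → Term

namespace Term

/-- Lifting of a renaming of variables below one abstraction. -/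
def upr (ρ : ℕ → ℕ) : ℕ → ℕ
  | 0 => 0
  | k + 1 => ρ k + 1

/-- Renaming of the free variables of a term. -/
def rename : (ℕ → ℕ) → Term → Term
  | ρ, var k => var (ρ k)
  | _, bot => bot
  | ρ, lam M => lam (rename (upr ρ) M)
  | ρ, app M N => app (rename ρ M) (rename ρ N)

/-- Lifting of a substitution below one abstraction. -/
def ups (σ : ℕ → Term) : ℕ → Term
  | 0 => var 0
  | k + 1 => rename Nat.succ (σ k)

/-- Simultaneous capture-avoiding substitution. -/
def subst : (ℕ → Term) → Term → Term
  | σ, var k => σ k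
  | _, bot => bot
  | σ, lam M => lam (subst (ups σ) M)
  | σ, app M N => app (subst σ M) (subst σ N)

/-- The substitution that replaces variable `0` by `N` and lowers the other variables by one. -/
def single (N : Term) : ℕ → Term
  | 0 => N
  | k + 1 => var k

/-- `inst M N` is the contractum `M{N/x}` of the `β`-redex `(λx.M)N`. -/
def inst (M N : Term) : Term := subst (single N) M

/-- `lams n M` is `λ x₁ … xₙ. M`; below these abstractions `xᵢ` is `var (n - i)`. -/
def lams : ℕ → Term → Term
  | 0, M => M
  | n + 1, M => lam (lams n M)

/-- `apps M [M₁, …, Mₘ]` is `M M₁ … Mₘ` (application associates to the left). -/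
def apps (M : Term) (Ms : List Term) : Term := Ms.foldl app M

end Term

open Term

/-- One-step `β⊥`-reduction, in an arbitrary context. -/
inductive Step : Term → Term → Prop
  | beta (M N : Term) : Step (app (lam M) N) (inst M N)
  | botApp (N : Term) : Step (app bot N) bot
  | botLam : Step (lam bot) bot
  | lam {M M' : Term} : Step M M' → Step (Term.lam M) (Term.lam M')
  | appL {M M' : Term} (N : Term) : Step M M' → Step (app M N) (app M' N)
  | appR (M : Term) {N N' : Term} : Step N N' → Step (app M N) (app M N')

/-- Many-step `β⊥`-reduction: finitely many steps, possibly none. -/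
def Reduces : Term → Term → Prop := Relation.ReflTransGen Step

/-- Equality of terms (`β⊥`-conversion): the two terms have a common reduct. -/
def Conv (M N : Term) : Prop := ∃ P : Term, Reduces M P ∧ Reduces N P

/-- `I = λx. x`. -/
def combI : Term := lam (var 0)

/-- `B = λxyz. x(yz)`. -/
def combB : Term := lams 3 (app (var 2) (app (var 1) (var 0)))

/-- `M ∘ N = B M N`. -/
def comp (M N : Term) : Term := app (app combB M) N

/-- `L` is a left inverse of `M`. -/
def IsLeftInverse (L M : Term) : Prop := Conv (comp L M) combI

/-- `M` has at least one left inverse. -/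
def LeftInvertible (M : Term) : Prop := ∃ L : Term, IsLeftInverse L M

/-- The set `Ξ` of head normal forms. Below the `n + 1` abstractions of `λ t x₁ … xₙ`, the
variable `t` is `var n` and `x₁, …, xₙ` are `var (n - 1), …, var 0`. The `base` clause says
`λ t x₁ … xₙ. t ∈ Ξ`; the `step` clause says that `λ t x₁ … xₙ. xⱼ M₁ … Mₘ ∈ Ξ` if
`λ t x₁ … xₙ. Mᵢ ∈ Ξ` for a component `Mᵢ`. -/
inductive Xi : Term → Prop
  | base (n : ℕ) : Xi (lams (n + 1) (var n))
  | step (n k : ℕ) (hk : k < n) (Ms : List Term) (N : Term) (hN : N ∈ Ms)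
      (h : Xi (lams (n + 1) N)) : Xi (lams (n + 1) (apps (var k) Ms))

/-- The selector `λ y₁ … yₘ. yᵢ` (meant for `1 ≤ i ≤ m`). -/
def selector (m i : ℕ) : Term := lams m (var (m - i))

/-- The permutator `λ z₁ … zₘ₊₁. zₘ₊₁ z₁ … zₘ` (meant for `1 ≤ m`). -/
def permutator (m : ℕ) : Term :=
  lams (m + 1) (apps (var 0) ((List.range m).map fun k => var (m - k)))

/-- `M` is a selector. -/
def IsSelector (M : Term) : Prop := ∃ m i : ℕ, 1 ≤ i ∧ i ≤ m ∧ M = selector m i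

/-- `M` is a permutator. -/
def IsPermutator (M : Term) : Prop := ∃ m : ℕ, 1 ≤ m ∧ M = permutator m

end LambdaBot

/-! If `L ∘ M = I`, standardization makes `L (M t)` weak head reduce to the variable `t`. Suppose
that `M` has no reduct in `Ξ`. Then `λt. M t` has none either (`Xi.of_eta`), so `t` occurs in `L (M
t)` only inside an instance of a `Bad` body. Weak head reduction keeps `t` confined in this way: an
abstraction of a bad body consumes a guarded argument, which becomes one more `x_j`; when `x_j M₁ …
Mₘ` comes to the head, every `M_i` is bad by the second clause of `Ξ`. Since `t` itself is not bad,
it is never reached (`Guarded.not_ev_apps`).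

Conversely, an element of `Ξ` contains a path to `t` that is followed by a Böhm-out argument. Every
`x_j` is replaced by the same permutator, whose `m` bounds the number of arguments at each node of
the path. At `x_j M₁ … M_p`, padding with `⊥` up to `m` arguments and then supplying a selector
extracts the wanted `M_i` (`reduces_permutator_select`); `Xi.exists_args` iterates this. A single
`m` is used because one variable may head several nodes with different numbers of arguments. -/

namespace LambdaBot

open Term

/-! ### Substitution calculus and application spines -/

namespace Term

/-- The substitution `σ` preceded by the term `N`. -/
def scons (N : Term) (σ : ℕ → Term) : ℕ → Term
  | 0 => N
  | k + 1 => σ k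

theorem single_eq_scons (N : Term) : single N = scons N var := by
  funext k; cases k <;> rfl

theorem rename_eq_subst (ρ : ℕ → ℕ) (M : Term) : rename ρ M = subst (fun k => var (ρ k)) M := by
  induction M generalizing ρ with
  | var k => rfl
  | bot => rfl
  | lam M ih =>
    simp only [rename, subst, ih]
    congr 2
    funext k; cases k <;> rfl
  | app M N ihM ihN => simp only [rename, subst, ihM, ihN]

theorem subst_rename (σ : ℕ → Term) (ρ : ℕ → ℕ) (M : Term) :
    subst σ (rename ρ M) = subst (fun k => σ (ρ k)) M := by
  induction M generalizing ρ σ with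
  | var k => rfl
  | bot => rfl
  | lam M ih =>
    simp only [rename, subst, ih]
    congr 2
    funext k; cases k <;> rfl
  | app M N ihM ihN => simp only [rename, subst, ihM, ihN]

theorem rename_rename (ρ' ρ : ℕ → ℕ) (M : Term) :
    rename ρ' (rename ρ M) = rename (fun k => ρ' (ρ k)) M := by
  rw [rename_eq_subst ρ', subst_rename, rename_eq_subst]

theorem rename_subst (ρ : ℕ → ℕ) (σ : ℕ → Term) (M : Term) :
    rename ρ (subst σ M) = subst (fun k => rename ρ (σ k)) M := by
  induction M generalizing ρ σ with
  | var k => rfl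
  | bot => rfl
  | lam M ih =>
    simp only [rename, subst, ih]
    congr 2
    funext k
    cases k with
    | zero => rfl
    | succ k =>
      simp only [ups, rename_rename]
      rfl
  | app M N ihM ihN => simp only [rename, subst, ihM, ihN]

theorem subst_subst (τ σ : ℕ → Term) (M : Term) :
    subst τ (subst σ M) = subst (fun k => subst τ (σ k)) M := by
  induction M generalizing τ σ with
  | var k => rfl
  | bot => rfl
  | lam M ih =>
    simp only [subst, ih]
    congr 2
    funext k
    cases k with
    | zero => rfl
    | succ k =>
      simp only [ups, subst_rename, rename_subst]
  | app M N ihM ihN => simp only [subst, ihM, ihN]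

theorem ups_var : ups var = var := by
  funext k; cases k <;> rfl

theorem subst_var (M : Term) : subst var M = M := by
  induction M with
  | var k => rfl
  | bot => rfl
  | lam M ih => rw [subst, ups_var, ih]
  | app M N ihM ihN => rw [subst, ihM, ihN]

/-- A β-step on an instance of an abstraction leaves its body intact and only extends the
substitution by the argument, as in an environment machine. Both halves of the theorem track
reductions in this form. -/
theorem inst_subst_ups (σ : ℕ → Term) (M N : Term) :
    inst (subst (ups σ) M) N = subst (scons N σ) M := by
  rw [inst, subst_subst]
  congr 1
  funext k
  cases k with
  | zero => rfl
  | succ k =>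
    simp only [ups, subst_rename]
    exact subst_var _

theorem subst_inst (σ : ℕ → Term) (M N : Term) :
    subst σ (inst M N) = subst (scons (subst σ N) σ) M := by
  rw [inst, subst_subst]
  congr 1
  funext k; cases k <;> rfl

theorem inst_eq (M N : Term) : inst M N = subst (scons N var) M := by
  rw [inst, single_eq_scons]

theorem apps_nil (M : Term) : apps M [] = M := rfl

theorem apps_cons (M N : Term) (Ns : List Term) : apps M (N :: Ns) = apps (app M N) Ns := rfl

theorem apps_append (M : Term) (Ns Ps : List Term) :
    apps M (Ns ++ Ps) = apps (apps M Ns) Ps := List.foldl_append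

theorem subst_apps (σ : ℕ → Term) (M : Term) (Ns : List Term) :
    subst σ (apps M Ns) = apps (subst σ M) (Ns.map (subst σ)) := by
  induction Ns generalizing M with
  | nil => rfl
  | cons N Ns ih => rw [apps_cons, ih]; rfl

theorem apps_app_eq (M N : Term) (Ns : List Term) :
    ∃ P Q, apps (app M N) Ns = app P Q := by
  induction Ns generalizing M N with
  | nil => exact ⟨M, N, rfl⟩
  | cons A Ns ih => exact ih _ _

theorem apps_var_ne_lam (k : ℕ) (Ns : List Term) (B : Term) : apps (var k) Ns ≠ lam B := by
  cases Ns with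
  | nil => simp [apps_nil]
  | cons N Ns =>
    obtain ⟨P, Q, h⟩ := apps_app_eq (var k) N Ns
    simp [apps_cons, h]

theorem apps_var_ne_bot (k : ℕ) (Ns : List Term) : apps (var k) Ns ≠ bot := by
  cases Ns with
  | nil => simp [apps_nil]
  | cons N Ns =>
    obtain ⟨P, Q, h⟩ := apps_app_eq (var k) N Ns
    simp [apps_cons, h]

theorem lams_add (a b : ℕ) (M : Term) : lams (a + b) M = lams a (lams b M) := by
  induction a with
  | zero => simp [lams]
  | succ a ih => rw [Nat.succ_add, lams, lams, ih]

theorem lams_succ' (n : ℕ) (M : Term) : lams (n + 1) M = lams n (lam M) := lams_add n 1 M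

/-- Cancellation of abstractions above a term that is not itself an abstraction. -/
theorem eq_lams_of_lams_eq {a b : ℕ} {M N : Term} (hM : ∀ B, M ≠ lam B)
    (h : lams a M = lams b N) : ∃ d, a = b + d ∧ N = lams d M := by
  induction b generalizing a with
  | zero => exact ⟨a, by simp, h.symm⟩
  | succ b ih =>
    cases a with
    | zero => exact absurd h (hM _)
    | succ a =>
      obtain ⟨d, rfl, hd⟩ := ih (Term.lam.inj h)
      exact ⟨d, by omega, hd⟩

end Term

/-! ### Reduction in context -/

theorem Reduces.lam {M M' : Term} (h : Reduces M M') : Reduces (lam M) (lam M') :=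
  Relation.ReflTransGen.lift Term.lam (fun _ _ => Step.lam) _ _ h

theorem Reduces.appL {M M' : Term} (N : Term) (h : Reduces M M') :
    Reduces (app M N) (app M' N) :=
  Relation.ReflTransGen.lift (fun X => app X N) (fun _ _ => Step.appL N) _ _ h

theorem Reduces.appR (M : Term) {N N' : Term} (h : Reduces N N') :
    Reduces (app M N) (app M N') :=
  Relation.ReflTransGen.lift (app M) (fun _ _ => Step.appR M) _ _ h

theorem Reduces.lams (n : ℕ) {M M' : Term} (h : Reduces M M') :
    Reduces (lams n M) (lams n M') := by
  induction n with
  | zero => exact h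
  | succ n ih => exact ih.lam

theorem Reduces.apps {M M' : Term} (Ns : List Term) (h : Reduces M M') :
    Reduces (apps M Ns) (apps M' Ns) := by
  induction Ns generalizing M M' with
  | nil => exact h
  | cons N Ns ih => exact ih (h.appL N)

theorem Reduces.of_lam {M H : Term} (h : Reduces (Term.lam M) H) :
    (∃ M', H = Term.lam M' ∧ Reduces M M') ∨ H = bot := by
  induction h with
  | refl => exact Or.inl ⟨M, rfl, Relation.ReflTransGen.refl⟩
  | tail _ hs ih =>
    rcases ih with ⟨M', rfl, hM⟩ | rfl
    · cases hs with
      | botLam => exact Or.inr rfl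
      | lam hs => exact Or.inl ⟨_, rfl, hM.tail hs⟩
    · cases hs

/-- Only `λx.⊥ → ⊥` can remove an abstraction of the prefix, and then the body has already become
`⊥`. -/
theorem Reduces.of_lams {n : ℕ} {M H : Term} (h : Reduces (Term.lams n M) H) :
    (∃ M', H = Term.lams n M' ∧ Reduces M M') ∨ ∃ j, H = Term.lams j bot := by
  induction n generalizing H with
  | zero => exact Or.inl ⟨H, rfl, h⟩
  | succ n ih =>
    rcases h.of_lam with ⟨M', rfl, hM⟩ | rfl
    · rcases ih hM with ⟨M'', rfl, hM'⟩ | ⟨j, rfl⟩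
      · exact Or.inl ⟨M'', rfl, hM'⟩
      · exact Or.inr ⟨j + 1, rfl⟩
    · exact Or.inr ⟨0, rfl⟩

theorem Xi.exists_eq {H : Term} (h : Xi H) :
    ∃ n k Ms, H = lams (n + 1) (apps (var k) Ms) := by
  cases h with
  | base n => exact ⟨n, n, [], rfl⟩
  | step n k hk Ms N hN h => exact ⟨n, k, Ms, rfl⟩

theorem Xi.ne_lams_bot {H : Term} (h : Xi H) (j : ℕ) : H ≠ lams j bot := by
  obtain ⟨n, k, Ms, rfl⟩ := h.exists_eq
  intro e
  obtain ⟨d, -, hd⟩ := eq_lams_of_lams_eq (apps_var_ne_lam k Ms) e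
  cases d with
  | zero => exact apps_var_ne_bot k Ms hd.symm
  | succ d => cases hd

/-! ### Weak head reduction and standardization -/

/-- One step of weak head reduction. -/
inductive WH : Term → Term → Prop
  | beta (M N : Term) : WH (app (lam M) N) (inst M N)
  | botApp (N : Term) : WH (app bot N) bot
  | appL {M M' : Term} (N : Term) : WH M M' → WH (app M N) (app M' N)

/-- Many-step weak head reduction. -/
abbrev WHs : Term → Term → Prop := Relation.ReflTransGen WH

theorem WH.det {M N N' : Term} (h : WH M N) (h' : WH M N') : N = N' := by
  induction h generalizing N' with
  | beta M N =>
    cases h' with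
    | beta => rfl
    | appL _ h => cases h
  | botApp N =>
    cases h' with
    | botApp => rfl
    | appL _ h => cases h
  | appL N h ih =>
    cases h' with
    | beta => cases h
    | botApp => cases h
    | appL _ h' => rw [ih h']

theorem WH.step {M N : Term} (h : WH M N) : Step M N := by
  induction h with
  | beta M N => exact Step.beta M N
  | botApp N => exact Step.botApp N
  | appL N _ ih => exact Step.appL N ih

theorem WH.subst {M N : Term} (σ : ℕ → Term) (h : WH M N) :
    WH (subst σ M) (subst σ N) := by
  induction h with
  | beta M N =>
    rw [subst_inst, ← inst_subst_ups]
    exact WH.beta _ _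
  | botApp N => exact WH.botApp _
  | appL N _ ih => exact WH.appL _ ih

theorem WH.apps {M N : Term} (Ns : List Term) (h : WH M N) : WH (apps M Ns) (apps N Ns) := by
  induction Ns generalizing M N with
  | nil => exact h
  | cons A Ns ih => exact ih (h.appL A)

theorem WHs.subst {M N : Term} (σ : ℕ → Term) (h : WHs M N) :
    WHs (subst σ M) (subst σ N) :=
  Relation.ReflTransGen.lift (Term.subst σ) (fun _ _ => WH.subst σ) _ _ h

theorem WHs.rename {M N : Term} (ρ : ℕ → ℕ) (h : WHs M N) :
    WHs (rename ρ M) (rename ρ N) := by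
  rw [rename_eq_subst, rename_eq_subst]
  exact h.subst _

theorem WHs.appL {M M' : Term} (N : Term) (h : WHs M M') : WHs (app M N) (app M' N) :=
  Relation.ReflTransGen.lift (fun X => app X N) (fun _ _ => WH.appL N) _ _ h

/-- Standard reduction: weak head reduction followed by standard reduction of the components. -/
inductive Std : Term → Term → Prop
  | var {M : Term} {k : ℕ} : WHs M (var k) → Std M (var k)
  | bot {M : Term} : WHs M bot → Std M bot
  | botLam {M B : Term} : WHs M (lam B) → Std B bot → Std M bot
  | lam {M B B' : Term} : WHs M (lam B) → Std B B' → Std M (lam B')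
  | app {M P Q P' Q' : Term} : WHs M (app P Q) → Std P P' → Std Q Q' → Std M (app P' Q')

theorem Std.refl (M : Term) : Std M M := by
  induction M with
  | var k => exact .var .refl
  | bot => exact .bot .refl
  | lam M ih => exact .lam .refl ih
  | app M N ihM ihN => exact .app .refl ihM ihN

theorem Std.of_WHs {M M' N : Term} (h : WHs M M') (h' : Std M' N) : Std M N := by
  cases h' with
  | var h' => exact .var (h.trans h')
  | bot h' => exact .bot (h.trans h')
  | botLam h' hB => exact .botLam (h.trans h') hB
  | lam h' hB => exact .lam (h.trans h') hB
  | app h' hP hQ => exact .app (h.trans h') hP hQ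

theorem Std.rename {M N : Term} (h : Std M N) (ρ : ℕ → ℕ) :
    Std (rename ρ M) (rename ρ N) := by
  induction h generalizing ρ with
  | var h => exact .var (h.rename ρ)
  | bot h => exact .bot (h.rename ρ)
  | botLam h _ ih => exact .botLam (h.rename ρ) (ih _)
  | lam h _ ih => exact .lam (h.rename ρ) (ih _)
  | app h _ _ ihP ihQ => exact .app (h.rename ρ) (ihP _) (ihQ _)

theorem Std.ups {σ σ' : ℕ → Term} (h : ∀ k, Std (σ k) (σ' k)) (k : ℕ) :
    Std (ups σ k) (ups σ' k) := by
  cases k with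
  | zero => exact .refl _
  | succ k => exact (h k).rename _

theorem Std.subst {M N : Term} (h : Std M N) {σ σ' : ℕ → Term} (hσ : ∀ k, Std (σ k) (σ' k)) :
    Std (subst σ M) (subst σ' N) := by
  induction h generalizing σ σ' with
  | var h => exact .of_WHs (h.subst σ) (hσ _)
  | bot h => exact .bot (h.subst σ)
  | botLam h _ ih => exact .botLam (h.subst σ) (ih (Std.ups hσ))
  | lam h _ ih => exact .lam (h.subst σ) (ih (Std.ups hσ))
  | app h _ _ ihP ihQ => exact .app (h.subst σ) (ihP hσ) (ihQ hσ)

theorem Std.inst {M M' N N' : Term} (hM : Std M M') (hN : Std N N') :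
    Std (inst M N) (inst M' N') := by
  refine hM.subst fun k => ?_
  cases k with
  | zero => exact hN
  | succ k => exact .refl _

/-- A standard reduction absorbs one more step at its end: a redex at the root is contracted by
prolonging the weak head part, any other inside a component. -/
theorem Std.step {M N N' : Term} (h : Std M N) (hs : Step N N') : Std M N' := by
  induction hs generalizing M with
  | beta B A =>
    cases h with
    | app h hP hQ =>
      cases hP with
      | lam hP hB =>
        exact .of_WHs ((h.trans (hP.appL _)).tail (.beta _ _)) (hB.inst hQ)
  | botApp A =>
    cases h with
    | app h hP hQ =>
      cases hP with
      | bot hP => exact .bot ((h.trans (hP.appL _)).tail (.botApp _))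
      -- Here the `⊥` in function position arose from some `λx.B` with `B` reducing to `⊥`. The
      -- β-redex is contracted instead, which suffices because `⊥{A/x}` is `⊥`.
      | botLam hP hB =>
        exact .of_WHs ((h.trans (hP.appL _)).tail (.beta _ _)) (hB.inst hQ)
  | botLam =>
    cases h with
    | lam h hB => exact .botLam h hB
  | lam _ ih =>
    cases h with
    | lam h hB => exact .lam h (ih hB)
  | appL A _ ih =>
    cases h with
    | app h hP hQ => exact .app h (ih hP) hQ
  | appR A _ ih =>
    cases h with
    | app h hP hQ => exact .app h hP (ih hQ)

/-- Standardization. -/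
theorem Reduces.std {M N : Term} (h : Reduces M N) : Std M N := by
  induction h with
  | refl => exact .refl _
  | tail _ hs ih => exact ih.step hs

/-! ### Left invertible terms reduce to `Ξ` -/

/-- Weak head reduction to the variable `t` in the given number of steps. -/
inductive Ev (t : ℕ) : ℕ → Term → Prop
  | zero : Ev t 0 (var t)
  | succ {n : ℕ} {M M' : Term} : WH M M' → Ev t n M' → Ev t (n + 1) M

theorem WHs.exists_ev {t : ℕ} {M : Term} (h : WHs M (var t)) : ∃ n, Ev t n M := by
  induction h using Relation.ReflTransGen.head_induction_on with
  | refl => exact ⟨0, .zero⟩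
  | head hs _ ih =>
    obtain ⟨n, hn⟩ := ih
    exact ⟨n + 1, .succ hs hn⟩

/-- A weak head step can be taken off an evaluation. -/
theorem Ev.of_WH {t n : ℕ} {M M' : Term} (h : Ev t n M) (hs : WH M M') :
    ∃ m < n, Ev t m M' := by
  cases h with
  | zero => cases hs
  | succ hs' h => exact ⟨_, Nat.lt_succ_self _, hs.det hs' ▸ h⟩

theorem not_WH_apps_var (k : ℕ) (Ns : List Term) (X : Term) : ¬ WH (apps (var k) Ns) X := by
  induction Ns using List.reverseRecOn generalizing X with
  | nil => intro h; cases h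
  | append_singleton Ns N ih =>
    rw [apps_append]
    generalize hY : apps (var k) Ns = Y at ih
    intro h
    cases h with
    | beta M => exact apps_var_ne_lam k Ns M hY
    | botApp => exact apps_var_ne_bot k Ns hY
    | appL _ h => exact ih _ h

theorem Ev.apps_var {t n k : ℕ} {Ns : List Term} (h : Ev t n (apps (var k) Ns)) :
    k = t ∧ Ns = [] := by
  generalize hY : apps (var k) Ns = Y at h
  cases h with
  | zero =>
    cases Ns with
    | nil => exact ⟨Term.var.inj hY, rfl⟩
    | cons N Ns =>
      obtain ⟨P, Q, h⟩ := apps_app_eq (var k) N Ns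
      rw [apps_cons, h] at hY
      cases hY
  | succ hs h => exact absurd (hY ▸ hs) (not_WH_apps_var k Ns _)

theorem not_ev_apps_bot (t n : ℕ) (Ns : List Term) : ¬ Ev t n (apps bot Ns) := by
  induction Ns generalizing n with
  | nil =>
    intro h
    cases h with
    | succ hs _ => cases hs
  | cons N Ns ih =>
    intro h
    obtain ⟨m, -, hm⟩ := h.of_WH (WH.apps Ns (.botApp N))
    exact ih m hm

theorem not_ev_lam (t n : ℕ) (B : Term) : ¬ Ev t n (lam B) := by
  intro h
  cases h with
  | succ hs _ => cases hs

/-- `P`, below abstractions of `t` (variable `n`) and then of `n` more variables, does not reduce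
to an element of `Ξ`. -/
def Bad (n : ℕ) (P : Term) : Prop := ∀ H, Reduces (lams (n + 1) P) H → ¬ Xi H

theorem Bad.of_reduces {n : ℕ} {P P' : Term} (h : Bad n P) (hr : Reduces P P') : Bad n P' :=
  fun H hH => h H ((hr.lams _).trans hH)

theorem Bad.of_lam {n : ℕ} {B : Term} (h : Bad n (lam B)) : Bad (n + 1) B := by
  intro H hH
  rw [lams_succ'] at hH
  exact h H hH

theorem not_bad_var (n : ℕ) : ¬ Bad n (var n) := fun h => h _ .refl (.base n)

/-- Contrapositive of `Xi.step`: a reduct of one component that lies in `Ξ` can be put in its place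
in the spine. -/
theorem Bad.of_apps_var {n k : ℕ} {Ps : List Term} (h : Bad n (apps (var k) Ps)) (hk : k < n)
    {P : Term} (hP : P ∈ Ps) : Bad n P := by
  intro H hH hXi
  rcases hH.of_lams with ⟨P', rfl, hr⟩ | ⟨j, rfl⟩
  · obtain ⟨Qs, Rs, rfl⟩ := List.append_of_mem hP
    refine h (lams (n + 1) (apps (var k) (Qs ++ P' :: Rs))) (Reduces.lams _ ?_)
      (.step n k hk _ P' (by simp) hXi)
    rw [apps_append, apps_append, apps_cons, apps_cons]
    exact (hr.appR _).apps Rs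
  · exact hXi.ne_lams_bot j rfl

/-- Terms in which the variable `t` occurs only as the distinguished variable of instances of
`Bad` terms. -/
inductive Guarded (t : ℕ) : Term → Prop
  | var {k : ℕ} : k ≠ t → Guarded t (var k)
  | app {M N : Term} : Guarded t M → Guarded t N → Guarded t (app M N)
  | subst (P : Term) (σ : ℕ → Term) : (∀ k, Guarded t (σ k)) → Guarded t (subst σ P)
  | bad (n : ℕ) (P : Term) (σ : ℕ → Term) (hP : Bad n P) :
      (∀ k < n, Guarded t (σ k)) → σ n = Term.var t →
      (∀ k, n < k → ∃ j, j ≠ t ∧ σ k = Term.var j) → Guarded t (subst σ P)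

/-- Outer induction on the length of the evaluation pays for each weak head step; inner induction on
the derivation of `Guarded` pays for looking up a variable in a substitution, where no step is made.
-/
theorem Guarded.not_ev_apps {t : ℕ} (N : ℕ) {T : Term} (hT : Guarded t T) (Ts : List Term)
    (hTs : ∀ A ∈ Ts, Guarded t A) : ¬ Ev t N (apps T Ts) := by
  induction N using Nat.strong_induction_on generalizing T Ts with
  | _ N ihN =>
  induction hT generalizing Ts with
  | var hk => exact fun h => hk h.apps_var.1
  | app _ hB ihA _ => exact ihA (_ :: Ts) (by simpa using ⟨hB, hTs⟩)
  | subst P σ hσ ih =>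
    induction P generalizing Ts with
    | var k => exact ih k Ts hTs
    | bot => exact not_ev_apps_bot _ _ _
    | lam B _ =>
      cases Ts with
      | nil => exact not_ev_lam _ _ _
      | cons A Ts =>
        intro h
        obtain ⟨m, hm, h⟩ := h.of_WH (WH.apps Ts (.beta _ A))
        rw [inst_subst_ups] at h
        simp only [List.mem_cons, forall_eq_or_imp] at hTs
        refine ihN m hm (.subst B (scons A σ) fun k => ?_) Ts hTs.2 h
        cases k with
        | zero => exact hTs.1
        | succ k => exact hσ k
    | app P Q ihP _ =>
      exact ihP (_ :: Ts) (by simpa using ⟨.subst Q σ hσ, hTs⟩)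
  | bad n P σ hP hlt heq hgt ih =>
    -- Badness belongs to the whole spine and is not inherited by its head, so the arguments `Ps`
    -- inside the bad term are kept apart from the outer ones `Ts`.
    suffices key : ∀ (P : Term) (Ps : List Term), Bad n (apps P Ps) →
        ¬ Ev t N (apps (Term.subst σ P) (Ps.map (Term.subst σ) ++ Ts)) from key P [] hP
    intro P
    induction P with
    | var y =>
      intro Ps hb h
      rcases lt_trichotomy y n with hy | rfl | hy
      -- The head is one of the `x_j`: its value has a smaller derivation, and the inner arguments
      -- are again instances of bad terms.
      · refine ih y hy _ (fun A hA => ?_) h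
        rcases List.mem_append.1 hA with hA | hA
        · obtain ⟨Q, hQ, rfl⟩ := List.mem_map.1 hA
          exact .bad n Q σ (hb.of_apps_var hy hQ) hlt heq hgt
        · exact hTs A hA
      · rw [Term.subst, heq] at h
        obtain ⟨-, h⟩ := h.apps_var
        obtain ⟨h, -⟩ := List.append_eq_nil_iff.1 h
        obtain rfl := List.map_eq_nil_iff.1 h
        exact not_bad_var _ hb
      · obtain ⟨j, hj, hσ⟩ := hgt y hy
        rw [Term.subst, hσ] at h
        exact hj h.apps_var.1
    | bot => exact fun Ps _ => not_ev_apps_bot _ _ _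
    | lam B _ =>
      intro Ps hb h
      cases Ps with
      | nil =>
        cases Ts with
        | nil => exact not_ev_lam _ _ _ h
        | cons A Ts =>
          obtain ⟨m, hm, h⟩ := h.of_WH (WH.apps Ts (.beta _ A))
          rw [inst_subst_ups] at h
          simp only [List.mem_cons, forall_eq_or_imp] at hTs
          -- The consumed argument becomes a new `x`, which moves `t` from index `n` to `n + 1`.
          refine ihN m hm (.bad (n + 1) B (scons A σ) hb.of_lam (fun k hk => ?_) heq
            fun k hk => ?_) Ts hTs.2 h
          · cases k with
            | zero => exact hTs.1
            | succ k => exact hlt k (by omega)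
          · cases k with
            | zero => omega
            | succ k => exact hgt k (by omega)
      | cons A Ps =>
        -- The redex lies inside the bad term, and badness is stable under reduction.
        obtain ⟨m, hm, h⟩ := h.of_WH (WH.apps (Ps.map (Term.subst σ) ++ Ts) (.beta _ _))
        rw [inst_subst_ups, ← subst_inst, apps_append, ← subst_apps] at h
        exact ihN m hm (.bad n _ σ
          (hb.of_reduces (.single (WH.apps Ps (.beta B A)).step)) hlt heq hgt) Ts hTs h
    | app P Q ihP _ => exact fun Ps hb => ihP (Q :: Ps) hb

theorem WHs.of_WH_of_normal {M M' N : Term} (h : WHs M N) (hs : WH M M')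
    (hN : ∀ X, ¬ WH N X) : WHs M' N := by
  rcases h.cases_head with rfl | ⟨X, hX, h⟩
  · exact absurd hs (hN _)
  · exact hs.det hX ▸ h

/-- `B L` is an abstraction, and `(B L) M` contracts to `λz. L (M z)`. -/
theorem exists_combB_app (L M : Term) : ∃ X, WH (app combB L) (lam X) ∧
    inst X M = lam (app (rename Nat.succ L) (app (rename Nat.succ M) (var 0))) := by
  refine ⟨_, .beta _ L, ?_⟩
  rw [inst_subst_ups]
  simp only [lams, subst, ups, scons, single, rename_eq_subst]

/-- Renaming creates no redex. This transfers reductions of the weakened `M` in `λt. M t` back to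
`M`. -/
theorem Step.of_rename {ρ : ℕ → ℕ} {M N : Term} (h : Step (rename ρ M) N) :
    ∃ N', N = rename ρ N' ∧ Step M N' := by
  generalize hX : rename ρ M = X at h
  induction h generalizing ρ M with
  | beta B A =>
    rcases M with _ | _ | _ | ⟨_ | _ | B', A'⟩ <;> simp [rename] at hX
    obtain ⟨rfl, rfl⟩ := hX
    refine ⟨_, ?_, .beta _ _⟩
    simp only [rename_eq_subst, inst_eq, subst_subst]
    congr 1
    funext k; cases k <;> rfl
  | botApp A =>
    rcases M with _ | _ | _ | ⟨_ | _ | _, A'⟩ <;> simp [rename] at hX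
    exact ⟨_, rfl, .botApp _⟩
  | botLam =>
    rcases M with _ | _ | ⟨_ | _ | _⟩ | _ <;> simp [rename] at hX
    exact ⟨bot, rfl, .botLam⟩
  | lam _ ih =>
    cases M <;> simp [rename] at hX
    obtain ⟨N', rfl, h⟩ := ih hX
    exact ⟨_, rfl, .lam h⟩
  | appL A _ ih =>
    cases M <;> simp [rename] at hX
    obtain ⟨N', rfl, h⟩ := ih hX.1
    exact ⟨app N' _, by rw [rename, hX.2], .appL _ h⟩
  | appR A _ ih =>
    cases M <;> simp [rename] at hX
    obtain ⟨N', rfl, h⟩ := ih hX.2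
    exact ⟨app _ N', by rw [rename, hX.1], .appR _ h⟩

theorem Reduces.of_rename {ρ : ℕ → ℕ} {M N : Term} (h : Reduces (rename ρ M) N) :
    ∃ N', N = rename ρ N' ∧ Reduces M N' := by
  induction h with
  | refl => exact ⟨M, rfl, .refl⟩
  | tail _ hs ih =>
    obtain ⟨N', rfl, hN⟩ := ih
    obtain ⟨N'', rfl, hs'⟩ := hs.of_rename
    exact ⟨N'', rfl, hN.tail hs'⟩

theorem Reduces.of_app_var {M Q : Term} {k : ℕ} (h : Reduces (app M (var k)) Q) :
    (∃ M', Q = app M' (var k) ∧ Reduces M M') ∨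
      (∃ B, Reduces M (Term.lam B) ∧ Reduces (inst B (var k)) Q) ∨ Q = bot := by
  induction h with
  | refl => exact Or.inl ⟨M, rfl, .refl⟩
  | tail _ hs ih =>
    rcases ih with ⟨M', rfl, hM⟩ | ⟨B, hM, hB⟩ | rfl
    · cases hs with
      | beta B => exact Or.inr (Or.inl ⟨B, hM, .refl⟩)
      | botApp => exact Or.inr (Or.inr rfl)
      | appL _ hs => exact Or.inl ⟨_, rfl, hM.tail hs⟩
      | appR _ hs => cases hs
    · exact Or.inr (Or.inl ⟨B, hM, hB.tail hs⟩)
    · cases hs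

theorem inst_rename_upr_succ (M : Term) : inst (rename (upr Nat.succ) M) (var 0) = M := by
  rw [inst_eq, subst_rename]
  conv_rhs => rw [← subst_var M]
  congr 1
  funext k; cases k <;> rfl

/-- If `λt. M t` reduces to an element of `Ξ`, so does `M`. -/
theorem Xi.of_eta {M H : Term} (h : Reduces (lam (app (rename Nat.succ M) (var 0))) H)
    (hH : Xi H) : Reduces M H := by
  rcases h.of_lam with ⟨Q, rfl, hQ⟩ | rfl
  · rcases hQ.of_app_var with ⟨M', rfl, -⟩ | ⟨B, hB, hQ⟩ | rfl
    -- An element of `Ξ` with the single abstraction `t` has no `x_j` to head an application, so it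
    -- can only be `λt.t`.
    · generalize hX : lam (app M' (var 0)) = X at hH
      cases hH with
      | base n => cases n <;> simp [lams] at hX
      | step n k hk =>
        cases n with
        | zero => omega
        | succ n => simp [lams] at hX
    · obtain ⟨N, hN, hM⟩ := hB.of_rename
      cases N <;> simp [rename] at hN
      subst hN
      rw [inst_rename_upr_succ] at hQ
      exact hM.trans hQ.lam
    · exact absurd rfl (hH.ne_lams_bot 1)
  · exact absurd rfl (hH.ne_lams_bot 0)

theorem LeftInvertible.exists_xi {M : Term} (h : LeftInvertible M) :
    ∃ H, Reduces M H ∧ Xi H := by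
  obtain ⟨L, P, hP, hI⟩ := h
  -- `I` is normal, so the common reduct is `I` itself.
  have hc : Reduces (comp L M) combI := by
    rcases hI.of_lam with ⟨X, rfl, hX⟩ | rfl
    · rcases hX.cases_head with rfl | ⟨Y, hY, -⟩
      · exact hP
      · cases hY
    · rcases hI.cases_head with h | ⟨Y, hY, -⟩
      · cases h
      · cases hY with
        | lam h => cases h
  by_contra hM
  push Not at hM
  cases hc.std with
  | lam hw hB =>
    obtain ⟨X, hX, hXM⟩ := exists_combB_app L M
    have hw := hw.of_WH_of_normal (hX.appL M) (fun X h => by cases h)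
    have hw := hw.of_WH_of_normal (.beta _ M) (fun X h => by cases h)
    rw [hXM] at hw
    rcases hw.cases_head with h | ⟨X, hX, -⟩
    · obtain rfl := Term.lam.inj h
      cases hB with
      | var hB =>
        obtain ⟨n, hn⟩ := hB.exists_ev
        refine Guarded.not_ev_apps n (T := app (rename Nat.succ L)
          (app (rename Nat.succ M) (var 0))) ?_ [] (by simp) hn
        refine .app ?_ ?_
        · rw [rename_eq_subst]
          exact .subst _ _ fun k => .var (by simp)
        · rw [← subst_var (app _ _)]
          -- `M t` is its own instance under `var`; no `x` has been introduced yet, so `n = 0`.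
          exact .bad 0 _ var (fun H hH hXi => hM H (hXi.of_eta hH) hXi) (by simp) rfl
            fun k hk => ⟨k, by omega, rfl⟩
    · cases hX

/-! ### Elements of `Ξ` have left inverses -/

/-- The substitution obtained from `σ` by pushing the terms of a list in turn. -/
def pushes (σ : ℕ → Term) : List Term → ℕ → Term
  | [] => σ
  | N :: Ns => pushes (scons N σ) Ns

theorem pushes_append (σ : ℕ → Term) (Ns Ps : List Term) :
    pushes σ (Ns ++ Ps) = pushes (pushes σ Ns) Ps := by
  induction Ns generalizing σ with
  | nil => rfl
  | cons N Ns ih => exact ih _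

theorem pushes_add_length (σ : ℕ → Term) (Ns : List Term) (k : ℕ) :
    pushes σ Ns (k + Ns.length) = σ k := by
  induction Ns generalizing σ k with
  | nil => rfl
  | cons N Ns ih =>
    rw [pushes, List.length_cons, ← add_assoc, add_right_comm, ih]
    rfl

theorem pushes_of_lt (σ : ℕ → Term) (Ns : List Term) {k : ℕ} (hk : k < Ns.length) :
    pushes σ Ns (Ns.length - 1 - k) = Ns[k] := by
  induction Ns generalizing σ k with
  | nil => simp at hk
  | cons N Ns ih =>
    cases k with
    | zero =>
      have := pushes_add_length (scons N σ) Ns 0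
      simpa [pushes, scons] using this
    | succ k =>
      have hk' : k < Ns.length := by simpa using hk
      rw [pushes, List.getElem_cons_succ, ← ih (scons N σ) hk', List.length_cons]
      congr 1
      omega

theorem reduces_apps_subst_lams (σ : ℕ → Term) (M : Term) (Ns : List Term) :
    Reduces (apps (subst σ (lams Ns.length M)) Ns) (subst (pushes σ Ns) M) := by
  induction Ns generalizing σ with
  | nil => exact .refl
  | cons N Ns ih =>
    refine .head (WH.apps Ns (.beta _ N)).step ?_
    rw [inst_subst_ups]
    exact ih _

/-- The hypothesis says that the prefix closes `M`. It is used to make selectors and permutators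
invariant under substitution. -/
theorem subst_lams_of_bound (n : ℕ) (M : Term) (h : ∀ σ τ : ℕ → Term,
    (∀ k < n, σ k = τ k) → subst σ M = subst τ M) (σ : ℕ → Term) :
    subst σ (lams n M) = lams n M := by
  suffices key : ∀ σ τ : ℕ → Term, subst σ (lams n M) = subst τ (lams n M) by
    rw [key σ var, subst_var]
  induction n generalizing M with
  | zero => exact fun σ τ => h σ τ (by simp)
  | succ n ih =>
    intro σ τ
    rw [lams_succ']
    refine ih (lam M) (fun σ τ hστ => ?_) σ τ
    rw [subst, subst, h]
    rintro (_ | k) hk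
    · rfl
    · simp only [ups, hστ k (by omega)]

theorem subst_permutator (σ : ℕ → Term) (m : ℕ) : subst σ (permutator m) = permutator m := by
  refine subst_lams_of_bound _ _ (fun σ τ h => ?_) σ
  rw [subst_apps, subst_apps, List.map_map, List.map_map]
  congr 1
  · exact h 0 (by omega)
  · exact List.map_congr_left fun k _ => h (m - k) (by omega)

theorem IsPermutator.subst {N : Term} (h : IsPermutator N) (σ : ℕ → Term) : subst σ N = N := by
  obtain ⟨m, -, rfl⟩ := h
  exact subst_permutator σ m

theorem IsSelector.subst {N : Term} (h : IsSelector N) (σ : ℕ → Term) : subst σ N = N := by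
  obtain ⟨m, i, hi, hm, rfl⟩ := h
  exact subst_lams_of_bound _ _ (fun σ τ h => by
    simpa only [Term.subst] using h (m - i) (by omega)) σ

theorem reduces_selector {Ns : List Term} {k : ℕ} (hk : k < Ns.length) :
    Reduces (apps (selector Ns.length (k + 1)) Ns) Ns[k] := by
  have h := reduces_apps_subst_lams var (var (Ns.length - (k + 1))) Ns
  rw [subst_var, subst, show Ns.length - (k + 1) = Ns.length - 1 - k by omega,
    pushes_of_lt var Ns hk] at h
  rwa [selector, show Ns.length - (k + 1) = Ns.length - 1 - k by omega]

theorem reduces_permutator (Ns : List Term) (N : Term) :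
    Reduces (apps (permutator Ns.length) (Ns ++ [N])) (apps N Ns) := by
  have h := reduces_apps_subst_lams var
    (apps (var 0) ((List.range Ns.length).map fun k => var (Ns.length - k))) (Ns ++ [N])
  rw [subst_var, subst_apps, List.map_map, List.length_append] at h
  have h0 : subst (pushes var (Ns ++ [N])) (var 0) = N := by
    rw [subst, pushes_append]; rfl
  have hs : (List.range Ns.length).map
      (subst (pushes var (Ns ++ [N])) ∘ fun k => var (Ns.length - k)) = Ns := by
    refine List.ext_getElem (by simp) fun k _ hk => ?_
    have := pushes_of_lt var (Ns ++ [N]) (k := k) (by simp; omega)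
    simp only [List.length_append, List.length_singleton, Nat.add_sub_cancel] at this
    simp [subst, this, hk]
  rwa [h0, hs] at h

/-- A large permutator, completed by `⊥`s and a selector, extracts any given argument. -/
theorem reduces_permutator_select {m k : ℕ} {Ns : List Term} (hm : Ns.length ≤ m)
    (hk : k < Ns.length) : Reduces (apps (permutator m)
      (Ns ++ (List.replicate (m - Ns.length) bot ++ [selector m (k + 1)]))) Ns[k] := by
  have hl : (Ns ++ List.replicate (m - Ns.length) bot).length = m := by simp; omega
  have h1 := reduces_permutator (Ns ++ List.replicate (m - Ns.length) bot) (selector m (k + 1))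
  have h2 := reduces_selector (Ns := Ns ++ List.replicate (m - Ns.length) bot) (k := k) (by omega)
  rw [List.getElem_append_left hk] at h2
  rw [hl] at h1 h2
  rw [← List.append_assoc]
  exact h1.trans h2

/-- The arguments allowed in a left inverse. -/
def IsSimple (N : Term) : Prop := N = bot ∨ IsSelector N ∨ IsPermutator N

theorem IsSimple.subst {N : Term} (h : IsSimple N) (σ : ℕ → Term) : subst σ N = N := by
  rcases h with rfl | h | h
  · rfl
  · exact h.subst σ
  · exact h.subst σ

/-- If every variable abstracted after `t` is replaced by a large enough permutator, then suitable
further arguments extract `t`. -/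
theorem Xi.exists_args {H : Term} (h : Xi H) : ∃ m₀, ∀ m, m₀ ≤ m → 1 ≤ m → ∀ n Q,
    H = lams (n + 1) Q → ∃ Ls : List Term, (∀ N ∈ Ls, IsSimple N) ∧ ∀ σ,
      Reduces (apps (subst (pushes σ (List.replicate n (permutator m))) Q) Ls) (σ 0) := by
  have simple_rep : ∀ {m : ℕ}, 1 ≤ m → ∀ d, ∀ N ∈ List.replicate d (permutator m), IsSimple N :=
    fun hm d N hN => Or.inr (Or.inr ⟨_, hm, List.eq_of_mem_replicate hN⟩)
  have pass : ∀ (m n d : ℕ) (M : Term) (σ : ℕ → Term), Reduces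
      (apps (subst (pushes σ (List.replicate n (permutator m))) (lams d M))
        (List.replicate d (permutator m)))
      (subst (pushes σ (List.replicate (n + d) (permutator m))) M) := by
    intro m n d M σ
    have := reduces_apps_subst_lams (pushes σ (List.replicate n (permutator m))) M
      (List.replicate d (permutator m))
    rwa [List.length_replicate, ← pushes_append, List.replicate_append_replicate] at this
  induction h with
  | base n' =>
    refine ⟨0, fun m _ hm n Q hQ => ?_⟩
    obtain ⟨d, hd, rfl⟩ := eq_lams_of_lams_eq (by simp) hQ
    obtain rfl : n' = n + d := by omega
    refine ⟨_, simple_rep hm d, fun σ => ?_⟩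
    have := pass m n d (var (n + d)) σ
    have h0 := pushes_add_length σ (List.replicate (n + d) (permutator m)) 0
    rw [List.length_replicate, zero_add] at h0
    rwa [subst, h0] at this
  | step n' k hk Ms N hN _ ih =>
    obtain ⟨m₀, ih⟩ := ih
    -- The permutator must accommodate this node and all later ones on the path.
    refine ⟨max m₀ Ms.length, fun m hm hm1 n Q hQ => ?_⟩
    -- `Q` may begin with `d` abstractions not yet instantiated; they are fed permutators before the
    -- node is opened.
    obtain ⟨d, hd, rfl⟩ := eq_lams_of_lams_eq (apps_var_ne_lam k Ms) hQ
    obtain rfl : n' = n + d := by omega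
    obtain ⟨Ls, hLs, hr⟩ := ih m (by omega) hm1 (n + d) N rfl
    have h_len : Ms.length ≤ m := by omega
    have hk' : ∀ σ, pushes σ (List.replicate (n + d) (permutator m)) k = permutator m := by
      intro σ
      have hlt : n + d - 1 - k < (List.replicate (n + d) (permutator m)).length := by
        simp; omega
      have := pushes_of_lt σ _ hlt
      rwa [List.length_replicate, List.getElem_replicate,
        show n + d - 1 - (n + d - 1 - k) = k by omega] at this
    obtain ⟨i, hi, rfl⟩ := List.getElem_of_mem hN
    refine ⟨List.replicate d (permutator m) ++
      ((List.replicate (m - Ms.length) bot ++ [selector m (i + 1)]) ++ Ls), ?_, fun σ => ?_⟩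
    · intro A hA
      simp only [List.mem_append, List.mem_singleton] at hA
      rcases hA with hA | (hA | rfl) | hA
      · exact simple_rep hm1 d A hA
      · exact Or.inl (List.eq_of_mem_replicate hA)
      · exact Or.inr (Or.inl ⟨m, i + 1, by omega, by omega, rfl⟩)
      · exact hLs A hA
    · rw [apps_append]
      refine (Reduces.apps _ (pass m n d _ σ)).trans ?_
      rw [subst_apps, subst, hk', ← apps_append, ← List.append_assoc, apps_append]
      refine .trans (Reduces.apps Ls ?_) (hr σ)
      have := reduces_permutator_select (m := m) (k := i)
        (Ns := Ms.map (subst (pushes σ (List.replicate (n + d) (permutator m)))))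
        (by simpa using h_len) (by simpa using hi)
      simpa only [List.getElem_map, List.length_map] using this

theorem Xi.exists_leftInverse {M H : Term} (hM : Reduces M H) (h : Xi H) :
    ∃ Ls : List Term, (∀ N ∈ Ls, IsSimple N) ∧
      IsLeftInverse (lam (apps (var 0) Ls)) M := by
  obtain ⟨n, k, Ms, hH⟩ := h.exists_eq
  obtain ⟨m₀, hm⟩ := h.exists_args
  -- With `n = 0` only `t` is instantiated, so `Ls` also supplies the permutators for the `x_j`. The
  -- successor secures `m ≥ 1`.
  obtain ⟨Ls, hLs, hr⟩ := hm (m₀ + 1) (by omega) (by omega) 0 _ hH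
  refine ⟨Ls, hLs, combI, ?_, .refl⟩
  have hmap : ∀ σ, Ls.map (subst σ) = Ls := fun σ =>
    (List.map_congr_left fun N hN => (hLs N hN).subst σ).trans (List.map_id Ls)
  obtain ⟨X, hX, hXH⟩ := exists_combB_app (lam (apps (var 0) Ls)) H
  refine (hM.appR _).trans (.head (.appL _ hX.step) (.head (.beta _ _) ?_))
  rw [hXH]
  refine Reduces.lam ?_
  rw [rename_eq_subst, subst, subst_apps, hmap]
  refine .head (.beta _ _) ?_
  rw [inst, subst_apps, hmap]
  refine .trans (Reduces.apps Ls ?_) (hr var)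
  subst hH
  refine .single ?_
  have := Step.beta (rename (upr Nat.succ) (lams n (apps (var k) Ms))) (var 0)
  rw [inst_rename_upr_succ] at this
  change Step _ (subst var _)
  rwa [subst_var]

end LambdaBot

theorem mainTheorem5 (M : LambdaBot.Term) :
    (LambdaBot.LeftInvertible M ↔
      ∃ H : LambdaBot.Term, LambdaBot.Reduces M H ∧ LambdaBot.Xi H) ∧
    ((∃ H : LambdaBot.Term, LambdaBot.Reduces M H ∧ LambdaBot.Xi H) →
      ∃ Ls : List LambdaBot.Term,
        (∀ N ∈ Ls, N = LambdaBot.Term.bot ∨ LambdaBot.IsSelector N ∨ LambdaBot.IsPermutator N) ∧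
        LambdaBot.IsLeftInverse
          (LambdaBot.Term.lam (LambdaBot.Term.apps (LambdaBot.Term.var 0) Ls)) M) := by
  refine ⟨⟨fun h => h.exists_xi, ?_⟩, ?_⟩
  · rintro ⟨H, hM, hH⟩
    obtain ⟨Ls, -, h⟩ := hH.exists_leftInverse hM
    exact ⟨_, h⟩
  · rintro ⟨H, hM, hH⟩
    exact hH.exists_leftInverse hM
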